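/- All graphs are finite and simple. For a graph $G$ with vertex set $V(G)$ and $m(G)$ edges, a set $D\subseteq V(G)$ is a total dominating set if every vertex of $G$ has a neighbor in $D$; the total domination number $\gamma_t(G)$ is the minimum cardinality of a total dominating set of $G$. The annihilation number $a(G)$ is the largest integer $k$ such that there are $k$ different vertices of $G$ whose degree sum is at most $m(G)$; equivalently, if $d_1\le d_2\le\dots\le d_n$ are the degrees of the vertices of $G$, it is the largest $k\in\{0,\dots,n\}$ with $\sum_{i=1}^{k} d_i\le m(G)$. A quasi-tree is a connected graph $G$ that has a vertex $x\in V(G)$ such that $G-x$ is a tree; it is non-trivial if $G$ itself is not a tree. Theorem. If $G$ is a non-trivial quasi-tree, then $\gamma_t(G)\le a(G)+1$. -/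

import Mathlib

namespace SimpleGraph

/-- `D` is a total dominating set of `G`: every vertex of `G` (including those of `D`) has a
neighbor in `D`. -/
def IsTotalDominatingSet {V : Type*} (G : SimpleGraph V) (D : Finset V) : Prop :=
  ∀ v : V, ∃ u ∈ D, G.Adj v u

/-- The total domination number `γ_t(G)`: the smallest cardinality of a total dominating set.
It is `⊤` if `G` has no total dominating set, so an upper bound `γ_t(G) ≤ k` with `k : ℕ` says
that a total dominating set with at most `k` vertices exists. -/
noncomputable def totalDominationNumber {V : Type*} (G : SimpleGraph V) : ℕ∞ :=
  ⨅ (D : Finset V) (_ : G.IsTotalDominatingSet D), (D.card : ℕ∞)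

/-- `S` is an annihilation set of `G`: the sum of the degrees of its vertices is at most the number
of edges of `G`. -/
def IsAnnihilationSet {V : Type*} [Fintype V] (G : SimpleGraph V) [DecidableRel G.Adj]
    (S : Finset V) : Prop :=
  ∑ v ∈ S, G.degree v ≤ G.edgeFinset.card

instance {V : Type*} [Fintype V] (G : SimpleGraph V) [DecidableRel G.Adj] :
    DecidablePred G.IsAnnihilationSet :=
  fun _ => Nat.decLe _ _

/-- The annihilation number `a(G)`: the largest integer `k` such that there are `k` different
vertices of `G` whose degree sum is at most the number of edges of `G`. (The empty set is an
annihilation set, so this is a maximum over a nonempty finite family.) -/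
def annihilationNumber {V : Type*} [Fintype V] (G : SimpleGraph V) [DecidableRel G.Adj] : ℕ :=
  (Finset.univ.filter fun S : Finset V => G.IsAnnihilationSet S).sup Finset.card

/-- A quasi-tree: a connected graph that has a vertex `x` such that `G - x` is a tree. -/
def IsQuasiTree {V : Type*} (G : SimpleGraph V) : Prop :=
  G.Connected ∧ ∃ x : V, (G.induce {x}ᶜ).IsTree

/-- A quasi-tree is non-trivial if it is not itself a tree. -/
def IsNontrivialQuasiTree {V : Type*} (G : SimpleGraph V) : Prop :=
  G.IsQuasiTree ∧ ¬ G.IsTree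

end SimpleGraph

/-!
Let `G - x` be a tree, `d` the degree of `x`, `n` the order of `G` and `ℓ` the number of vertices of
degree one. Then `m(G) = n - 2 + d`, and `d ≥ 2` because `G` is not a tree. Two upper bounds on
`γ_t(G)` are combined: `3 γ_t ≤ 2 n` and `2 γ_t ≤ n + ℓ + d`.

Both come from the same levels: choose a neighbour `y` of `x`, put `x` on level `0` and every
other vertex `v` on level `1 + dist_{G - x}(y, v)`. Every vertex other than `x` has a neighbour one
level below (a parent), and most vertices also have one a level above (a child).

* `IsLeveling.exists_three_mul_card_le`: for each residue `c`, the levels not congruent to `c`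
  modulo `3` can be turned into a total dominating set of the same size by exchanging the childless
  vertices on the levels `c + 1` for their parents. The three sets together have size at most `2 n`.
* `IsLeveling.exists_two_mul_card_le`: the levels congruent to `0, 1` modulo `4` and those congruent
  to `2, 3` are complementary, and a vertex with both a parent and a child has a neighbour in each
  of them. Each of the other vertices (the childless ones and `x`) costs one extra vertex in only
  one of the two sets. A childless vertex has degree one or is adjacent to `x`, so there are at most
  `ℓ + d` such vertices.

Suppose now `γ_t ≥ a + 2`, where `a` is the annihilation number. Every set of `a + 1` vertices
has degree sum at least `m + 1`. If some such set contains all vertices of degree one and otherwise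
only vertices of degree two, this gives `2 (a + 1) - ℓ ≥ m + 1`, against the second bound. If
instead such a set contains all vertices of degree at most two, its complement consists of vertices
of degree at least three and has degree sum at most `m - 1`, against the first bound.
-/

namespace SimpleGraph

variable {V : Type*} {G : SimpleGraph V}

lemma totalDominationNumber_le_card {D : Finset V} (hD : G.IsTotalDominatingSet D) :
    G.totalDominationNumber ≤ (D.card : ℕ∞) :=
  iInf₂_le D hD

lemma IsAnnihilationSet.card_le_annihilationNumber [Fintype V] [DecidableRel G.Adj]
    {S : Finset V} (hS : G.IsAnnihilationSet S) : S.card ≤ G.annihilationNumber :=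
  Finset.le_sup (f := Finset.card) (Finset.mem_filter.mpr ⟨Finset.mem_univ _, hS⟩)

/-! ### Constructions of total dominating sets -/

/-- Exchanging the vertices of `E ⊆ W` for neighbours of theirs does not increase the size of `W`;
the vertices of `E` are then dominated, so only those outside `E` need to be checked. -/
lemma exists_isTotalDominatingSet_of_exchange {W E : Finset V} (p : V → V) (hEW : E ⊆ W)
    (hp : ∀ v ∈ E, G.Adj v (p v))
    (hdom : ∀ v ∉ E, ∃ u, G.Adj v u ∧ ((u ∈ W ∧ u ∉ E) ∨ ∃ w ∈ E, p w = u)) :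
    ∃ D : Finset V, G.IsTotalDominatingSet D ∧ D.card ≤ W.card := by
  classical
  refine ⟨(W \ E) ∪ E.image p, fun v => ?_, ?_⟩
  · by_cases hv : v ∈ E
    · exact ⟨p v, Finset.mem_union_right _ (Finset.mem_image_of_mem p hv), hp v hv⟩
    · obtain ⟨u, hu, h⟩ := hdom v hv
      refine ⟨u, ?_, hu⟩
      simpa using h
  · have h1 := Finset.card_union_le (W \ E) (E.image p)
    have h2 : (E.image p).card ≤ E.card := Finset.card_image_le
    have h3 := Finset.card_sdiff_add_card_eq_card hEW
    omega

/-- If every vertex outside `B` has a neighbour in `U` and one outside `U`, then completing `U` and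
its complement costs at most one vertex per element of `B` in total. -/
lemma exists_isTotalDominatingSet_two_mul_card_le [Fintype V] (U B : Finset V)
    (hB : ∀ v ∈ B, ∃ u, G.Adj v u)
    (hin : ∀ v ∉ B, ∃ u, G.Adj v u ∧ u ∈ U) (hout : ∀ v ∉ B, ∃ u, G.Adj v u ∧ u ∉ U) :
    ∃ D : Finset V, G.IsTotalDominatingSet D ∧ 2 * D.card ≤ Fintype.card V + B.card := by
  classical
  have hex : ∀ v, ∃ u, G.Adj v u := fun v => by
    by_cases hv : v ∈ B
    · exact hB v hv
    · exact (hin v hv).imp fun _ h => h.1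
  choose p hp using hex
  have key : ∀ W : Finset V, (∀ v ∉ B, ∃ u, G.Adj v u ∧ u ∈ W) →
      G.IsTotalDominatingSet (W ∪ (B.filter fun v => p v ∉ W).image p) := by
    intro W hW v
    by_cases hv : v ∈ B
    · refine ⟨p v, ?_, hp v⟩
      by_cases hpv : p v ∈ W
      · exact Finset.mem_union_left _ hpv
      · exact Finset.mem_union_right _
          (Finset.mem_image_of_mem p (Finset.mem_filter.mpr ⟨hv, hpv⟩))
    · obtain ⟨u, hu, huW⟩ := hW v hv
      exact ⟨u, Finset.mem_union_left _ huW, hu⟩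
  have hcard : ∀ W : Finset V, (W ∪ (B.filter fun v => p v ∉ W).image p).card ≤
      W.card + (B.filter fun v => p v ∉ W).card := fun W =>
    (Finset.card_union_le _ _).trans (Nat.add_le_add_left Finset.card_image_le _)
  have h1 := hcard U
  have h2 := hcard Uᶜ
  have h3 := Finset.card_add_card_compl U
  have h4 := Finset.card_filter_add_card_filter_not (s := B) (fun v => p v ∈ U)
  simp only [Finset.mem_compl, not_not] at h2
  by_cases hle : U.card + (B.filter fun v => p v ∉ U).card ≤
      Uᶜ.card + (B.filter fun v => p v ∈ U).card
  · exact ⟨_, key U hin, by omega⟩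
  · refine ⟨_, key Uᶜ fun v hv => ?_, ?_⟩
    · simpa using hout v hv
    · simp only [Finset.mem_compl, not_not]
      omega

/-! ### Levels -/

/-- `h` assigns levels to the vertices of `G` such that `x` is the only vertex on level `0`, its
neighbour `y` is the only vertex on level `1`, there is a neighbour of `y` on level `2`, and every
vertex other than `x` has a neighbour exactly one level below. Edges of `G` that join the same level
or distant levels are allowed. -/
structure IsLeveling (G : SimpleGraph V) (h : V → ℕ) (x y : V) : Prop where
  root : ∀ v, h v = 0 ↔ v = x
  second : ∀ v, h v = 1 ↔ v = y
  adj : G.Adj x y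
  parent : ∀ v, v ≠ x → ∃ u, G.Adj v u ∧ h u + 1 = h v
  child : ∃ z, G.Adj y z ∧ h z = 2

/-- `v` has no neighbour exactly one level above it. -/
def IsChildless (G : SimpleGraph V) (h : V → ℕ) (v : V) : Prop :=
  ∀ u, G.Adj v u → h u ≠ h v + 1

namespace IsLeveling

variable {h : V → ℕ} {x y : V}

lemma exists_parent_map (hl : G.IsLeveling h x y) :
    ∃ p : V → V, p x = y ∧ (∀ v, G.Adj v (p v)) ∧ ∀ v, v ≠ x → h (p v) + 1 = h v := by
  have hex : ∀ v, ∃ u, G.Adj v u ∧ (v = x → u = y) ∧ (v ≠ x → h u + 1 = h v) := fun v => by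
    by_cases hv : v = x
    · exact ⟨y, hv ▸ hl.adj, fun _ => rfl, fun h => absurd hv h⟩
    · obtain ⟨u, hu, huv⟩ := hl.parent v hv
      exact ⟨u, hu, fun h => absurd h hv, fun _ => huv⟩
  choose p hp using hex
  exact ⟨p, (hp x).2.1 rfl, fun v => (hp v).1, fun v => (hp v).2.2⟩

/-- The levels outside one residue class modulo `3` can be modified to a total dominating set. The
root needs care only for the class of level `1`: it may lack a neighbour, and is then itself
exchanged for `y`. -/
lemma exists_card_le_card_filter_ne [Fintype V] (hl : G.IsLeveling h x y) {c : ℕ} (hc : c < 3) :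
    ∃ D : Finset V, G.IsTotalDominatingSet D ∧
      D.card ≤ (Finset.univ.filter fun v => h v % 3 ≠ c).card := by
  classical
  obtain ⟨p, hpx, hp, hph⟩ := hl.exists_parent_map
  have hx : h x = 0 := (hl.root x).2 rfl
  have hy : h y = 1 := (hl.second y).2 rfl
  obtain ⟨z, hyz, hz⟩ := hl.child
  -- The root joins the exchanged vertices if `c = 1` and no child of `y` is exchanged for `y`.
  refine exists_isTotalDominatingSet_of_exchange p
    (E := Finset.univ.filter fun v => (v ≠ x ∧ h v % 3 = (c + 1) % 3 ∧ G.IsChildless h v) ∨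
      (v = x ∧ c = 1 ∧ ∀ w, G.Adj y w → h w = 2 → ¬ G.IsChildless h w)) ?_ (fun v _ => hp v) ?_
  · intro v hv
    simp only [Finset.mem_filter, Finset.mem_univ, true_and] at hv ⊢
    rcases hv with hv | ⟨rfl, hc1, -⟩ <;> omega
  intro v hv
  simp only [Finset.mem_filter, Finset.mem_univ, true_and] at hv ⊢
  push Not at hv
  have hyc : ¬ G.IsChildless h y := fun H => H z hyz (by omega)
  by_cases hvx : v = x
  · subst hvx
    refine ⟨y, hl.adj, ?_⟩
    have hyv : y ≠ v := hl.adj.ne'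
    by_cases hc1 : c = 1
    · obtain ⟨w, hyw, hw, hwc⟩ := hv.2 rfl hc1
      have hwv : w ≠ v := by rintro rfl; omega
      have hpw : p w = y := (hl.second _).1 (by have := hph w hwv; omega)
      exact Or.inr ⟨w, Or.inl ⟨hwv, by omega, hwc⟩, hpw⟩
    · refine Or.inl ⟨by omega, ?_⟩
      rintro (⟨-, -, H⟩ | ⟨H, -⟩)
      · exact hyc H
      · exact hyv H
  have hpv := hph v hvx
  by_cases h1 : h v % 3 = (c + 1) % 3
  · have hvc : ¬ G.IsChildless h v := hv.1 hvx h1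
    simp only [IsChildless, not_forall, not_not] at hvc
    obtain ⟨u, hvu, hu⟩ := hvc
    refine ⟨u, hvu, Or.inl ⟨by omega, ?_⟩⟩
    rintro (⟨-, H, -⟩ | ⟨rfl, -⟩) <;> omega
  by_cases h2 : h v % 3 = c
  · by_cases hvy : v = y
    · subst hvy
      by_cases hall : ∀ w, G.Adj v w → h w = 2 → ¬ G.IsChildless h w
      · refine ⟨z, hyz, Or.inl ⟨by omega, ?_⟩⟩
        rintro (⟨-, -, H⟩ | ⟨rfl, -⟩)
        · exact hall z hyz hz H
        · omega
      · refine ⟨x, hl.adj.symm, Or.inl ⟨by omega, ?_⟩⟩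
        rintro (⟨H, -⟩ | ⟨-, -, H⟩)
        · exact H rfl
        · exact hall H
    · refine ⟨p v, hp v, Or.inl ⟨by omega, ?_⟩⟩
      rintro (⟨-, H, -⟩ | ⟨H, -⟩)
      · omega
      · refine hvy ((hl.second v).1 ?_)
        rw [H] at hpv
        omega
  · refine ⟨p v, hp v, Or.inl ⟨by omega, ?_⟩⟩
    rintro (⟨-, -, H⟩ | ⟨H, hc1, -⟩)
    · exact H v (hp v).symm hpv.symm
    · rw [H] at hpv
      omega

lemma exists_three_mul_card_le [Fintype V] (hl : G.IsLeveling h x y) :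
    ∃ D : Finset V, G.IsTotalDominatingSet D ∧ 3 * D.card ≤ 2 * Fintype.card V := by
  classical
  obtain ⟨D₀, h₀, c₀⟩ := hl.exists_card_le_card_filter_ne (c := 0) (by norm_num)
  obtain ⟨D₁, h₁, c₁⟩ := hl.exists_card_le_card_filter_ne (c := 1) (by norm_num)
  obtain ⟨D₂, h₂, c₂⟩ := hl.exists_card_le_card_filter_ne (c := 2) (by norm_num)
  have hsum : (Finset.univ.filter fun v => h v % 3 ≠ 0).card +
      (Finset.univ.filter fun v => h v % 3 ≠ 1).card +
      (Finset.univ.filter fun v => h v % 3 ≠ 2).card = 2 * Fintype.card V := by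
    simp only [Finset.card_filter, ← Finset.sum_add_distrib]
    rw [Finset.sum_congr rfl (g := fun _ => 2), Finset.sum_const, Finset.card_univ, smul_eq_mul,
      mul_comm]
    intro v _
    have : h v % 3 < 3 := Nat.mod_lt _ (by norm_num)
    split_ifs <;> omega
  by_cases d₀ : 3 * D₀.card ≤ 2 * Fintype.card V
  · exact ⟨D₀, h₀, d₀⟩
  by_cases d₁ : 3 * D₁.card ≤ 2 * Fintype.card V
  · exact ⟨D₁, h₁, d₁⟩
  exact ⟨D₂, h₂, by omega⟩

lemma exists_two_mul_card_le [Fintype V] (hl : G.IsLeveling h x y) (B : Finset V)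
    (hx : x ∈ B) (hB : ∀ v, G.IsChildless h v → v ∈ B) :
    ∃ D : Finset V, G.IsTotalDominatingSet D ∧ 2 * D.card ≤ Fintype.card V + B.card := by
  classical
  obtain ⟨p, -, hp, hph⟩ := hl.exists_parent_map
  have hpc : ∀ v ∉ B, h (p v) + 1 = h v ∧ ∃ u, G.Adj v u ∧ h u = h v + 1 := fun v hv => by
    refine ⟨hph v fun H => hv (H ▸ hx), ?_⟩
    have := mt (hB v) hv
    simpa [IsChildless] using this
  -- The levels of a parent and of a child of `v` differ by two.
  refine exists_isTotalDominatingSet_two_mul_card_le (Finset.univ.filter fun v => h v % 4 < 2) B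
    (fun v _ => ⟨p v, hp v⟩) (fun v hv => ?_) (fun v hv => ?_) <;>
  · obtain ⟨h1, u, hu, h2⟩ := hpc v hv
    simp only [Finset.mem_filter, Finset.mem_univ, true_and]
    by_cases h3 : h v % 4 = 0 ∨ h v % 4 = 3
    · first
        | exact ⟨u, hu, by omega⟩
        | exact ⟨p v, hp v, by omega⟩
    · first
        | exact ⟨p v, hp v, by omega⟩
        | exact ⟨u, hu, by omega⟩

end IsLeveling

/-! ### Distances in a tree and levels of a quasi-tree -/

lemma IsTree.eq_of_adj_of_dist_add_one (hG : G.IsTree) {r u v w : V} (hu : G.Adj u v)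
    (hw : G.Adj w v) (hdu : G.dist r u + 1 = G.dist r v) (hdw : G.dist r w + 1 = G.dist r v) :
    u = w := by
  obtain ⟨p, hp⟩ := hG.connected.exists_walk_length_eq_dist r u
  obtain ⟨q, hq⟩ := hG.connected.exists_walk_length_eq_dist r w
  have h1 : (p.concat hu).IsPath :=
    Walk.isPath_of_length_eq_dist _ (by rw [Walk.length_concat, hp, hdu])
  have h2 : (q.concat hw).IsPath :=
    Walk.isPath_of_length_eq_dist _ (by rw [Walk.length_concat, hq, hdw])
  have h3 := (hG.existsUnique_path r v).unique h1 h2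
  simpa using congrArg Walk.penultimate h3

lemma Connected.exists_adj_dist_add_one (hG : G.Connected) {r v : V} (hv : v ≠ r) :
    ∃ u, G.Adj v u ∧ G.dist r u + 1 = G.dist r v := by
  obtain ⟨p, hp⟩ := hG.exists_walk_length_eq_dist v r
  cases p with
  | nil => exact absurd rfl hv
  | @cons _ u _ hu q =>
    refine ⟨u, hu, ?_⟩
    have h1 := dist_le q
    have h2 := hu.diff_dist_adj (u := r)
    rw [Walk.length_cons] at hp
    rw [dist_comm (u := u)] at h1
    rw [dist_comm (u := v)] at hp
    omega

/-- The levels `0` at `x` and `1 + dist_{G - x}(y, ·)` elsewhere. If a vertex other than `x` has no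
child, then its only neighbours are its parent and possibly `x`. -/
lemma exists_isLeveling_of_isTree_induce [Fintype V] [DecidableRel G.Adj] {x y : V}
    (hT : (G.induce {x}ᶜ).IsTree) (hxy : G.Adj x y) (hd : 2 ≤ G.degree x) :
    ∃ h : V → ℕ, G.IsLeveling h x y ∧
      ∀ v, v ≠ x → G.IsChildless h v → v ≠ y ∧ (G.degree v = 1 ∨ G.Adj x v) := by
  classical
  set F := G.induce ({x}ᶜ : Set V) with hF
  let y' : ({x}ᶜ : Set V) := ⟨y, hxy.ne'⟩
  let h : V → ℕ := fun v => if hv : v ≠ x then F.dist y' ⟨v, hv⟩ + 1 else 0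
  have hh : ∀ v : ({x}ᶜ : Set V), h v = F.dist y' v + 1 := fun v => dif_pos v.2
  have hx : h x = 0 := by simp [h]
  have hl : G.IsLeveling h x y := by
    refine ⟨fun v => ?_, fun v => ?_, hxy, fun v hv => ?_, ?_⟩
    · refine ⟨fun H => ?_, fun H => H ▸ hx⟩
      by_contra hv
      have h1 := hh ⟨v, hv⟩
      change h v = _ at h1
      omega
    · by_cases hv : v = x
      · subst hv
        simp [hx, hxy.ne]
      · have h1 := hh ⟨v, hv⟩
        have h2 := hT.connected.dist_eq_zero_iff (u := y') (v := ⟨v, hv⟩)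
        rw [Subtype.ext_iff] at h2
        change h v = _ at h1
        change _ ↔ y = v at h2
        rw [h1, Nat.add_eq_right, h2, eq_comm]
    · by_cases hvy : v = y
      · subst hvy
        refine ⟨x, hxy.symm, ?_⟩
        have h1 := hh y'
        rw [dist_self] at h1
        rw [hx]
        exact h1.symm
      · obtain ⟨u, hu, hd⟩ := hT.connected.exists_adj_dist_add_one (r := y') (v := ⟨v, hv⟩)
          (fun H => hvy (congrArg Subtype.val H))
        have h1 := hh ⟨v, hv⟩
        exact ⟨u, hu, by rw [hh u, hd]; exact h1.symm⟩
    · obtain ⟨w, hw, hwy⟩ : ∃ w ∈ G.neighborFinset x, w ≠ y :=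
        Finset.exists_mem_ne (by rwa [card_neighborFinset_eq_degree]) y
      rw [mem_neighborFinset] at hw
      have : Nontrivial ({x}ᶜ : Set V) :=
        ⟨y', ⟨w, hw.ne'⟩, fun H => hwy (congrArg Subtype.val H).symm⟩
      obtain ⟨z, hz⟩ := hT.connected.preconnected.exists_adj_of_nontrivial y'
      exact ⟨z, hz, by rw [hh z, dist_eq_one_iff_adj.2 hz]⟩
  refine ⟨h, hl, fun v hv hvc => ?_⟩
  have hvy : v ≠ y := by
    rintro rfl
    obtain ⟨z, hz, hz2⟩ := hl.child
    exact hvc z hz (by rw [hz2, (hl.second v).2 rfl])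
  refine ⟨hvy, or_iff_not_imp_right.2 fun hxv => ?_⟩
  obtain ⟨u, hu, hd⟩ := hT.connected.exists_adj_dist_add_one (r := y') (v := ⟨v, hv⟩)
    (fun H => hvy (congrArg Subtype.val H))
  rw [degree_eq_one_iff_existsUnique_adj]
  refine ⟨u, hu, fun w hw => ?_⟩
  have hwx : w ≠ x := by rintro rfl; exact hxv hw.symm
  have hw' : F.Adj ⟨v, hv⟩ ⟨w, hwx⟩ := hw
  refine congrArg Subtype.val (hT.eq_of_adj_of_dist_add_one (u := ⟨w, hwx⟩) hw'.symm hu.symm ?_ hd)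
  have h1 := hT.dist_eq_dist_add_one_of_adj y' hw'
  have h2 := hvc w hw
  have h3 := hh ⟨v, hv⟩
  have h4 := hh ⟨w, hwx⟩
  change h v = _ at h3
  change h w = _ at h4
  omega

lemma card_edgeFinset_add_two_of_isTree_induce [Fintype V] [DecidableRel G.Adj] {x : V}
    (hT : (G.induce {x}ᶜ).IsTree) :
    G.edgeFinset.card + 2 = Fintype.card V + G.degree x := by
  classical
  have h1 := hT.card_edgeFinset
  have h2 := G.card_edgeFinset_induce_compl_singleton x
  have h3 := G.card_edgeFinset_deleteIncidenceSet x
  have h4 := G.degree_le_card_edgeFinset x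
  have h5 : Fintype.card ({x}ᶜ : Set V) = Fintype.card V - 1 := by
    rw [Fintype.card_compl_set]
    simp
  have h6 : 0 < Fintype.card V := Fintype.card_pos_iff.2 ⟨x⟩
  have h7 : (G.induce ({x}ᶜ : Set V)).edgeFinset.card + 1 = Fintype.card ({x}ᶜ : Set V) := by
    convert h1
  have h8 : (G.induce ({x}ᶜ : Set V)).edgeFinset.card = G.edgeFinset.card - G.degree x := by
    rw [← h3, ← h2]
  omega

lemma two_le_degree_of_isTree_induce [Fintype V] [DecidableRel G.Adj] {x : V}
    (hG : G.Connected) (hnT : ¬ G.IsTree) (hT : (G.induce {x}ᶜ).IsTree) : 2 ≤ G.degree x := by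
  classical
  obtain ⟨⟨v, hv⟩⟩ := hT.connected.nonempty
  have : Nontrivial V := ⟨v, x, hv⟩
  have h1 := hG.preconnected.degree_pos_of_nontrivial x
  by_contra h2
  refine hnT (isTree_iff_connected_and_card.2 ⟨hG, ?_⟩)
  have h3 := card_edgeFinset_add_two_of_isTree_induce hT
  rw [Nat.card_eq_fintype_card, Nat.card_eq_fintype_card, ← edgeFinset_card]
  omega

/-! ### Comparison with the annihilation number -/

/-- The two bounds on total domination in a form that no longer mentions levels. -/
lemma exists_isTotalDominatingSet_of_isTree_induce [Fintype V] [DecidableRel G.Adj] {x : V}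
    (hT : (G.induce {x}ᶜ).IsTree) (hd : 2 ≤ G.degree x) :
    (∃ D : Finset V, G.IsTotalDominatingSet D ∧ 3 * D.card ≤ 2 * Fintype.card V) ∧
    ∃ D : Finset V, G.IsTotalDominatingSet D ∧
      2 * D.card ≤ Fintype.card V + (Finset.univ.filter fun v => G.degree v = 1).card +
        G.degree x := by
  classical
  obtain ⟨y, hxy⟩ := (G.degree_pos_iff_exists_adj x).1 (by omega)
  obtain ⟨h, hl, hc⟩ := exists_isLeveling_of_isTree_induce hT hxy hd
  refine ⟨hl.exists_three_mul_card_le, ?_⟩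
  obtain ⟨D, hD, hcard⟩ := hl.exists_two_mul_card_le
    (insert x ((Finset.univ.filter fun v => G.degree v = 1) ∪ (G.neighborFinset x).erase y))
    (Finset.mem_insert_self _ _) (fun v hv => by
      by_cases hvx : v = x
      · simp [hvx]
      · obtain ⟨h1, h2⟩ := hc v hvx hv
        simp [hvx, h1, h2])
  refine ⟨D, hD, ?_⟩
  have h1 := Finset.card_insert_le x
    ((Finset.univ.filter fun v => G.degree v = 1) ∪ (G.neighborFinset x).erase y)
  have h2 := Finset.card_union_le (Finset.univ.filter fun v => G.degree v = 1)
    ((G.neighborFinset x).erase y)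
  have h3 : ((G.neighborFinset x).erase y).card = G.degree x - 1 := by
    rw [Finset.card_erase_of_mem (by simpa using hxy), card_neighborFinset_eq_degree]
  omega

end SimpleGraph

theorem theorem1p2 {V : Type*} [Fintype V] (G : SimpleGraph V) [DecidableRel G.Adj]
    (hG : G.IsNontrivialQuasiTree) :
    G.totalDominationNumber ≤ (G.annihilationNumber : ℕ∞) + 1 := by
  classical
  obtain ⟨⟨hconn, x, hT⟩, hnT⟩ := hG
  have hd := SimpleGraph.two_le_degree_of_isTree_induce hconn hnT hT
  have hm := SimpleGraph.card_edgeFinset_add_two_of_isTree_induce hT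
  obtain ⟨⟨D₁, hD₁, h₁⟩, D₂, hD₂, h₂⟩ :=
    SimpleGraph.exists_isTotalDominatingSet_of_isTree_induce hT hd
  have hpos : ∀ v, 1 ≤ G.degree v := fun v => by
    obtain ⟨u, -, hu⟩ := hD₁ v
    exact hu.degree_pos_left
  by_contra hcon
  set a := G.annihilationNumber with ha
  have hbig : ∀ D : Finset V, G.IsTotalDominatingSet D → a + 2 ≤ D.card := fun D hD => by
    by_contra hlt
    refine hcon ((SimpleGraph.totalDominationNumber_le_card hD).trans ?_)
    have : D.card ≤ a + 1 := by omega
    exact_mod_cast this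
  have hD₁' := hbig D₁ hD₁
  have hD₂' := hbig D₂ hD₂
  have hS : ∀ S : Finset V, S.card = a + 1 → G.edgeFinset.card + 1 ≤ ∑ v ∈ S, G.degree v :=
    fun S hcard => by
      by_contra hlt
      have hann : G.IsAnnihilationSet S := by
        unfold SimpleGraph.IsAnnihilationSet
        omega
      have := hann.card_le_annihilationNumber
      omega
  set L := Finset.univ.filter fun v => G.degree v = 1 with hL
  set A := Finset.univ.filter fun v => G.degree v ≤ 2 with hA
  have hLA : L ⊆ A := fun v hv => by
    simp only [hL, hA, Finset.mem_filter, Finset.mem_univ, true_and] at hv ⊢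
    omega
  rcases le_total (a + 1) L.card with hcL | hcL
  · obtain ⟨S, hSL, hSc⟩ := Finset.exists_subset_card_eq hcL
    have h3 := hS S hSc
    rw [Finset.sum_congr rfl (g := fun _ => 1) fun v hv => (Finset.mem_filter.1 (hSL hv)).2,
      Finset.sum_const, hSc, smul_eq_mul] at h3
    omega
  rcases le_total (a + 1) A.card with hcA | hcA
  · obtain ⟨S, hLS, hSA, hSc⟩ := Finset.exists_subsuperset_card_eq hLA hcL hcA
    have h3 := hS S hSc
    have h4 : ∑ v ∈ S, (G.degree v + if v ∈ L then 1 else 0) ≤ ∑ _v ∈ S, 2 := by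
      refine Finset.sum_le_sum fun v hv => ?_
      have h5 : G.degree v ≤ 2 := (Finset.mem_filter.1 (hSA hv)).2
      split_ifs with h6
      · have : G.degree v = 1 := (Finset.mem_filter.1 h6).2
        omega
      · exact h5
    rw [Finset.sum_add_distrib, ← Finset.card_filter, Finset.filter_mem_eq_inter,
      Finset.inter_eq_right.2 hLS, Finset.sum_const, hSc, smul_eq_mul] at h4
    -- Only parity separates `2 γ_t ≤ m + 2 + ℓ` from `m + 1 + ℓ ≤ 2 (a + 1)`.
    omega
  -- The vertex `x` may have large degree, so it is kept out of `S` whenever possible.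
  obtain ⟨S, hAS, hxS, hSc⟩ : ∃ S : Finset V, A ⊆ S ∧ (x ∉ A → x ∉ S) ∧ S.card = a + 1 := by
    by_cases hxA : x ∈ A
    · obtain ⟨S, h3, -, h4⟩ := Finset.exists_subsuperset_card_eq (Finset.subset_univ A) hcA
        (by rw [Finset.card_univ]; omega)
      exact ⟨S, h3, fun h => absurd hxA h, h4⟩
    · obtain ⟨S, h3, h5, h4⟩ := Finset.exists_subsuperset_card_eq
        (t := Finset.univ.erase x) (fun v hv =>
          Finset.mem_erase.2 ⟨fun H => hxA (H ▸ hv), Finset.mem_univ v⟩) hcA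
        (by rw [Finset.card_erase_of_mem (Finset.mem_univ x), Finset.card_univ]; omega)
      exact ⟨S, h3, fun _ H => (Finset.mem_erase.1 (h5 H)).1 rfl, h4⟩
  have h3 := hS S hSc
  have h4 := Finset.sum_add_sum_compl S fun v => G.degree v
  rw [G.sum_degrees_eq_twice_card_edges] at h4
  have h5 : Sᶜ.card = Fintype.card V - (a + 1) := by rw [Finset.card_compl, hSc]
  have hthree : ∀ v ∉ S, 3 ≤ G.degree v := fun v hv => by
    by_contra hlt
    exact hv (hAS (Finset.mem_filter.2 ⟨Finset.mem_univ v, by omega⟩))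
  by_cases hxA : x ∈ A
  · have hx2 : G.degree x ≤ 2 := (Finset.mem_filter.1 hxA).2
    have h6 := Finset.card_nsmul_le_sum Sᶜ (fun v => G.degree v) 3
      fun v hv => hthree v (Finset.mem_compl.1 hv)
    rw [smul_eq_mul, h5] at h6
    omega
  · have hxc : x ∈ Sᶜ := Finset.mem_compl.2 (hxS hxA)
    have h6 := Finset.card_nsmul_le_sum (Sᶜ.erase x) (fun v => G.degree v) 3
      fun v hv => hthree v (Finset.mem_compl.1 (Finset.mem_of_mem_erase hv))
    have h7 := Finset.add_sum_erase Sᶜ (fun v => G.degree v) hxc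
    rw [smul_eq_mul, Finset.card_erase_of_mem hxc, h5] at h6
    omega
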